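/- For a positive integer $d$ let $\mathsf{L}(\mathbb{C}^d)$ be the space of linear operators on $\mathbb{C}^d$. A linear map $\Phi:\mathsf{L}(\mathbb{C}^d)\to\mathsf{L}(\mathbb{C}^d)$ is a \emph{measure-and-prepare channel} if there are finitely many positive semidefinite operators $M_1,\dots,M_m$ on $\mathbb{C}^d$ with $\sum_y M_y=\mathbb{1}$ (a POVM) and density operators $\tau_1,\dots,\tau_m$ on $\mathbb{C}^d$ (positive semidefinite, of trace $1$) such that $\Phi(X)=\sum_{y}\mathrm{Tr}(M_yX)\,\tau_y$ for all $X\in\mathsf{L}(\mathbb{C}^d)$. Let $\mathcal{MP}(\mathbb{C}^d)$ be the set of these channels, let $\mathrm{id}$ be the identity map on $\mathsf{L}(\mathbb{C}^d)$, and define $$p^\star(d):=\inf\Big\{\sum_{i=1}^n|a_i| \;:\; n\in\mathbb{N},\ a_i\in\mathbb{R},\ \Phi_i\in\mathcal{MP}(\mathbb{C}^d),\ \mathrm{id}=\sum_{i=1}^n a_i\Phi_i\Big\}\in[0,\infty].$$ Then $p^\star(d)\geq\Omega(\sqrt d)$: there is an absolute constant $c>0$ such that $p^\star(d)\geq c\sqrt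 d$ for every integer $d\geq 1$. -/

import Mathlib

open scoped ENNReal ComplexOrder

/-- A density operator (quantum state) on `ℂ^d`: positive semidefinite with unit trace. -/
def IsDensity {d : ℕ} (τ : Matrix (Fin d) (Fin d) ℂ) : Prop :=
  τ.PosSemidef ∧ τ.trace = 1

/-- A POVM on `ℂ^d` with finitely many outcomes. -/
def IsPOVM {d m : ℕ} (M : Fin m → Matrix (Fin d) (Fin d) ℂ) : Prop :=
  (∀ y, (M y).PosSemidef) ∧ ∑ y, M y = 1

/-- `MP d` is the set of measure-and-prepare channels on `L(ℂ^d)`: measure some POVM `(M y)`, then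
prepare the state `τ y` upon outcome `y`, i.e. `X ↦ ∑ y, Tr (M y X) τ y`. -/
def MP (d : ℕ) : Set (Matrix (Fin d) (Fin d) ℂ →ₗ[ℂ] Matrix (Fin d) (Fin d) ℂ) :=
  {Φ | ∃ (m : ℕ) (M τ : Fin m → Matrix (Fin d) (Fin d) ℂ),
    IsPOVM M ∧ (∀ y, IsDensity (τ y)) ∧ ∀ X, Φ X = ∑ y, (M y * X).trace • τ y}

/-- The infimum of `∑ i, |a i|` over all decompositions `id = ∑ i, a i • Φ i` of the identity map on
`L(ℂ^d)` into finitely many measure-and-prepare channels with real coefficients (taken in `[0, ∞]`,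
so that it would be `∞`, not `0`, if there were no decomposition). -/
noncomputable def pStar (d : ℕ) : ℝ≥0∞ :=
  sInf {r | ∃ (n : ℕ) (a : Fin n → ℝ)
      (Φ : Fin n → (Matrix (Fin d) (Fin d) ℂ →ₗ[ℂ] Matrix (Fin d) (Fin d) ℂ)),
    (∀ i, Φ i ∈ MP d) ∧ LinearMap.id = ∑ i, (a i : ℂ) • Φ i ∧
      r = ENNReal.ofReal (∑ i, |a i|)}

/-! View a map on `L(ℂ^d)` as an operator on a `d²`-dimensional space and take its trace. The
identity has trace `d²`, while a measure-and-prepare channel has trace `∑ Tr (M y τ y)`, of modulus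
at most `∑ Tr (M y) = d`. The triangle inequality gives `d² ≤ d ∑ |a i|`, a bound linear in `d`. -/

open Matrix in
/-- For complex matrices, `tr (Bᴴ B)` is the sum of the squared norms of the entries of `B`. -/
theorem trace_conjTranspose_mul_self_eq_sum {d : ℕ} (B : Matrix (Fin d) (Fin d) ℂ) :
    (Bᴴ * B).trace = ((∑ i, ∑ j, ‖B i j‖ ^ 2 : ℝ) : ℂ) := by
  rw [Finset.sum_comm]
  push_cast
  simp only [Matrix.trace, Matrix.diag_apply, Matrix.mul_apply, Matrix.conjTranspose_apply]
  refine Finset.sum_congr rfl fun i _ => Finset.sum_congr rfl fun j _ => ?_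
  exact Complex.conj_mul' _

open Matrix in
/-- The sum of the squared norms of the entries of a matrix is submultiplicative. -/
theorem sum_norm_sq_mul_le {d : ℕ} (B C : Matrix (Fin d) (Fin d) ℂ) :
    ∑ i, ∑ j, ‖(B * C) i j‖ ^ 2 ≤ (∑ i, ∑ j, ‖B i j‖ ^ 2) * ∑ i, ∑ j, ‖C i j‖ ^ 2 := by
  rw [Finset.sum_comm (f := fun i j => ‖C i j‖ ^ 2), Finset.sum_mul_sum]
  refine Finset.sum_le_sum fun i _ => Finset.sum_le_sum fun j _ => ?_
  calc ‖(B * C) i j‖ ^ 2 ≤ (∑ k, ‖B i k‖ * ‖C k j‖) ^ 2 := by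
        gcongr
        rw [Matrix.mul_apply]
        exact (norm_sum_le _ _).trans_eq (by simp only [norm_mul])
    _ ≤ _ := Finset.sum_mul_sq_le_sq_mul_sq _ _ _

open Matrix MatrixOrder Matrix.Norms.L2Operator in
/-- For positive semidefinite `M` and `τ`, `|tr (M τ)| ≤ tr M * tr τ`. -/
theorem norm_trace_mul_le_of_posSemidef {d : ℕ} {M τ : Matrix (Fin d) (Fin d) ℂ}
    (hM : M.PosSemidef) (hτ : τ.PosSemidef) :
    ‖(M * τ).trace‖ ≤ M.trace.re * τ.trace.re := by
  obtain ⟨B, rfl⟩ := CStarAlgebra.nonneg_iff_eq_star_mul_self.mp hM.nonneg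
  obtain ⟨C, rfl⟩ := CStarAlgebra.nonneg_iff_eq_star_mul_self.mp hτ.nonneg
  simp only [star_eq_conjTranspose]
  -- By cyclicity the trace is the squared Hilbert–Schmidt norm of `B * Cᴴ`, and that norm is
  -- submultiplicative.
  have h : (Bᴴ * B * (Cᴴ * C)).trace = ((B * Cᴴ)ᴴ * (B * Cᴴ)).trace := by
    rw [conjTranspose_mul, conjTranspose_conjTranspose, ← Matrix.mul_assoc, trace_mul_comm]
    simp only [Matrix.mul_assoc]
  rw [h, trace_conjTranspose_mul_self_eq_sum, trace_conjTranspose_mul_self_eq_sum,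
    trace_conjTranspose_mul_self_eq_sum, Complex.ofReal_re, Complex.ofReal_re,
    Complex.norm_real, Real.norm_of_nonneg (by positivity)]
  refine (sum_norm_sq_mul_le B Cᴴ).trans_eq ?_
  congr 1
  rw [Finset.sum_comm]
  simp [conjTranspose_apply]

/-- The trace of a linear map on matrices, computed in the basis of matrix units. -/
noncomputable def superTrace (d : ℕ) :
    (Matrix (Fin d) (Fin d) ℂ →ₗ[ℂ] Matrix (Fin d) (Fin d) ℂ) →ₗ[ℂ] ℂ where
  toFun Φ := ∑ i, ∑ j, Φ (Matrix.single i j 1) i j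
  map_add' Φ Ψ := by simp [Finset.sum_add_distrib]
  map_smul' c Φ := by simp [Finset.mul_sum]

theorem superTrace_id (d : ℕ) : superTrace d LinearMap.id = (d : ℂ) * d := by
  simp [superTrace]

/-- Each term `X ↦ Tr (M y X) τ y` has rank at most one, so its trace is the functional evaluated at
`τ y`. -/
theorem norm_superTrace_le_of_mem_MP {d : ℕ}
    {Φ : Matrix (Fin d) (Fin d) ℂ →ₗ[ℂ] Matrix (Fin d) (Fin d) ℂ} (hΦ : Φ ∈ MP d) :
    ‖superTrace d Φ‖ ≤ d := by
  obtain ⟨m, M, τ, ⟨hM, hsum⟩, hτ, hΦ⟩ := hΦ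
  have h : superTrace d Φ = ∑ y, (M y * τ y).trace := by
    simp only [superTrace, LinearMap.coe_mk, AddHom.coe_mk, hΦ, Matrix.sum_apply,
      Matrix.smul_apply, Matrix.trace_mul_single, smul_eq_mul]
    rw [Finset.sum_comm]
    simp_rw [Finset.sum_comm (s := Finset.univ (α := Fin d)) (t := Finset.univ (α := Fin m))]
    simp [Matrix.trace, Matrix.mul_apply]
  calc ‖superTrace d Φ‖ ≤ ∑ y, ‖(M y * τ y).trace‖ := h ▸ norm_sum_le _ _
    _ ≤ ∑ y, (M y).trace.re := Finset.sum_le_sum fun y _ => by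
        simpa [(hτ y).2] using norm_trace_mul_le_of_posSemidef (hM y) (hτ y).1
    _ = d := by
        rw [← Complex.re_sum, ← Matrix.trace_sum, hsum]
        simp

/-- Every decomposition of the identity into measure-and-prepare channels has total weight at
least `d`. -/
theorem le_sum_abs_of_id_eq_sum {d n : ℕ} (hd : 0 < d) {a : Fin n → ℝ}
    {Φ : Fin n → (Matrix (Fin d) (Fin d) ℂ →ₗ[ℂ] Matrix (Fin d) (Fin d) ℂ)}
    (hΦ : ∀ i, Φ i ∈ MP d) (hid : LinearMap.id = ∑ i, (a i : ℂ) • Φ i) :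
    (d : ℝ) ≤ ∑ i, |a i| := by
  have hd' : (0 : ℝ) < d := by exact_mod_cast hd
  refine le_of_mul_le_mul_right ?_ hd'
  calc (d : ℝ) * d = ‖superTrace d LinearMap.id‖ := by simp [superTrace_id]
    _ = ‖∑ i, (a i : ℂ) * superTrace d (Φ i)‖ := by simp [hid]
    _ ≤ ∑ i, |a i| * d := (norm_sum_le _ _).trans <| Finset.sum_le_sum fun i _ => by
        rw [norm_mul, Complex.norm_real, Real.norm_eq_abs]
        exact mul_le_mul_of_nonneg_left (norm_superTrace_le_of_mem_MP (hΦ i)) (abs_nonneg _)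
    _ = (∑ i, |a i|) * d := (Finset.sum_mul _ _ _).symm

theorem mainTheorem4 :
    ∃ c : ℝ, 0 < c ∧ ∀ d : ℕ, 0 < d → ENNReal.ofReal (c * Real.sqrt d) ≤ pStar d := by
  refine ⟨1, one_pos, fun d hd => le_sInf ?_⟩
  rintro _ ⟨n, a, Φ, hΦ, hid, rfl⟩
  -- The linear bound suffices with `c = 1`, since `√d ≤ d` for `d ≥ 1`.
  refine ENNReal.ofReal_le_ofReal (le_trans ?_ (le_sum_abs_of_id_eq_sum hd hΦ hid))
  have h1 : (1 : ℝ) ≤ d := by exact_mod_cast hd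
  rw [one_mul, Real.sqrt_le_left (by positivity)]
  nlinarith
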